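/- Let $p$ be a prime, let $\mathbb{Z}_p=\{a/b\mid a,b\in\mathbb{Z},\ p\nmid b\}$ be the localization of $\mathbb{Z}$ at $p$, and for nonzero $a\in\mathbb{Z}_p$ let $[a]$ denote the non-negative integer $r$ with $a\mathbb{Z}_p=p^r\mathbb{Z}_p$. Let $0,\alpha,\beta$ be distinct integers, let $$R=\mathbb{Z}_p[X]/X(X-\alpha)(X-\beta)\mathbb{Z}_p[X],$$ and let $\zeta_R(s)=\sum_I |R:I|^{-s}$, where $I$ runs through the ideals of $R$ of finite index. Write $x=p^{-s}$. If $([\alpha],[\beta],[\beta-\alpha])=(1,1,1)$, then $R$ has only finitely many ideals of each finite index, and $$(1-x)^3\zeta_R(s)=p^3x^6-2p^2x^5+(p^2+p)x^4+(p^2-2p)x^3+(p+1)x^2-2x+1,$$ both as an identity of formal Dirichlet series and as an identity of functions of $s\in\mathbb{C}$ with $\operatorname{Re}(s)>0$, where the series defining $\zeta_R(s)$ converges absolutely. -/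

import Mathlib

/-- The ideal `pℤ` is prime. -/
instance cubicOrder_span_isPrime (p : ℕ) [hp : Fact p.Prime] :
    (Ideal.span {(p : ℤ)}).IsPrime :=
  (Ideal.span_singleton_prime (Int.natCast_ne_zero.mpr hp.out.ne_zero)).mpr
    (Nat.prime_iff_prime_int.mp hp.out)

namespace CubicOrder

/-- The localization `{a / b | a, b ∈ ℤ, p ∤ b}` of `ℤ` at the prime `p`
(not its completion). -/
abbrev Zloc (p : ℕ) [Fact p.Prime] : Type :=
  Localization.AtPrime (Ideal.span {(p : ℤ)})

/-- The valuation `[a]`: the `r` with `a Zloc = p ^ r Zloc` for `a ≠ 0`, and `[0] = ⊤`. -/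
noncomputable def val (p : ℕ) [Fact p.Prime] (a : Zloc p) : ℕ∞ :=
  emultiplicity (p : Zloc p) a

/-- The cubic polynomial `x (x - α) (x - β)` over the localization at `p`. -/
noncomputable def cubic (p : ℕ) [Fact p.Prime] (α β : ℤ) : Polynomial (Zloc p) :=
  Polynomial.X * (Polynomial.X - Polynomial.C (α : Zloc p)) *
    (Polynomial.X - Polynomial.C (β : Zloc p))

/-- The ring `R`, the quotient of the polynomial ring over the localization at `p` by the ideal
generated by `x (x - α) (x - β)`. -/
abbrev R (p : ℕ) [Fact p.Prime] (α β : ℤ) : Type :=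
  AdjoinRoot (cubic p α β)

/-- The full ideals of `R`: those of finite index. -/
abbrev FullIdeal (p : ℕ) [Fact p.Prime] (α β : ℤ) : Type :=
  {I : Ideal (R p α β) // Finite (R p α β ⧸ I)}

/-- The index `|R : I|`. -/
noncomputable def index (p : ℕ) [Fact p.Prime] (α β : ℤ) (I : FullIdeal p α β) : ℕ :=
  Nat.card (R p α β ⧸ I.1)

/-- The zeta function of `R`, the sum of `|R : I| ^ (-s)` over all full ideals `I`. -/
noncomputable def zeta (p : ℕ) [Fact p.Prime] (α β : ℤ) (s : ℂ) : ℂ :=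
  ∑' I : FullIdeal p α β, (index p α β I : ℂ) ^ (-s)

/-- The zeta function of `R` as a formal Dirichlet series: its `n`-th coefficient is the number of
ideals of index `n`. The product of `ArithmeticFunction ℤ` is Dirichlet convolution, which is the
product of formal Dirichlet series. -/
noncomputable def formalZeta (p : ℕ) [Fact p.Prime] (α β : ℤ) : ArithmeticFunction ℤ where
  toFun n := if n = 0 then 0 else (Nat.card {I : FullIdeal p α β // index p α β I = n} : ℤ)
  map_zero' := by simp

/-- The formal Dirichlet series `p ^ (-s)`. -/
def formalX (p : ℕ) [hp : Fact p.Prime] : ArithmeticFunction ℤ where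
  toFun n := if n = p then 1 else 0
  map_zero' := if_neg hp.out.ne_zero.symm

end CubicOrder

/-! Write `O` for the localization at `p` and `ϖ` for `p`. In the basis `1, X, X (X - α)` the ring
is `O ^ 3` with multiplication by `X` triangular, and ideals of finite index are the finite-index
submodules of `O ^ 3` stable under it. Each such submodule has a Hermite normal form with diagonal
`ϖ ^ a, ϖ ^ b, ϖ ^ c` and off-diagonal entries `u, v, w`; its index is `p ^ (a + b + c)`.

Stability amounts to the three congruences of `stable_lattice_iff`. The hypothesis says that `α = ϖ
A`, `β = ϖ B`, `β - α = ϖ D` with `A, B, D` units. If all exponents are positive, one factor `ϖ`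
cancels from the first and third congruences, so `u` and `w` are governed by residues `s` and `t`.
The remaining congruence is solvable for `v` exactly when one equation in `s, t` holds over the
residue field, and then `v` has `p` values (`natCard_stableLattices_succ`). Counting the solutions
of that equation (`natCard_residuePairs`) gives the number of ideals for each diagonal
(`natCard_stableLattices`).

This number sees each exponent only as `0`, `1` or at least `2`. Hence the generating function by
index is a finite combination of products of three factors among `1`, `x`, `x ^ 2 / (1 - x)`, and
`(1 - x) ^ 3` clears the denominators (`one_sub_X_pow_mul_latticeSeries`). The formal identity is
the image of this power series identity under `x ↦ p ^ (-s)`; the analytic one is its value at `x =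
p ^ (-s)`, where `‖x‖ < 1`. -/

namespace CubicOrder

/-! ### Lattices in Hermite normal form: stability, uniqueness, existence, index. -/

section Lattice

variable {O : Type*} [CommRing O]

/-- The linear map whose matrix has the rows `(ϖ ^ a, u, v)`, `(0, ϖ ^ b, w)`, `(0, 0, ϖ ^ c)`. -/
def hermiteMap (ϖ : O) (a b c : ℕ) (u v w : O) : (O × O × O) →ₗ[O] (O × O × O) where
  toFun x := (x.1 * ϖ ^ a, x.1 * u + x.2.1 * ϖ ^ b, x.1 * v + x.2.1 * w + x.2.2 * ϖ ^ c)
  map_add' x y := by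
    ext <;> simp <;> ring
  map_smul' r x := by
    ext <;> simp <;> ring

/-- The lattice with Hermite normal form `(ϖ ^ a, u, v)`, `(0, ϖ ^ b, w)`, `(0, 0, ϖ ^ c)`. -/
def lattice (ϖ : O) (a b c : ℕ) (u v w : O) : Submodule O (O × O × O) :=
  LinearMap.range (hermiteMap ϖ a b c u v w)

theorem mem_lattice {ϖ : O} {a b c : ℕ} {u v w x y z : O} :
    (x, y, z) ∈ lattice ϖ a b c u v w ↔ ∃ i j k, x = i * ϖ ^ a ∧ y = i * u + j * ϖ ^ b ∧
      z = i * v + j * w + k * ϖ ^ c := by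
  simp only [lattice, LinearMap.mem_range, hermiteMap, LinearMap.coe_mk, AddHom.coe_mk,
    Prod.exists, Prod.mk.injEq]
  exact ⟨fun ⟨i, j, k, h₁, h₂, h₃⟩ => ⟨i, j, k, h₁.symm, h₂.symm, h₃.symm⟩,
    fun ⟨i, j, k, h₁, h₂, h₃⟩ => ⟨i, j, k, h₁.symm, h₂.symm, h₃.symm⟩⟩

theorem lattice_le_iff {ϖ : O} {a b c : ℕ} {u v w : O} {L : Submodule O (O × O × O)} :
    lattice ϖ a b c u v w ≤ L ↔ (ϖ ^ a, u, v) ∈ L ∧ (0, ϖ ^ b, w) ∈ L ∧ (0, 0, ϖ ^ c) ∈ L := by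
  constructor
  · intro h
    refine ⟨h ?_, h ?_, h ?_⟩
    · exact mem_lattice.2 ⟨1, 0, 0, by simp⟩
    · exact mem_lattice.2 ⟨0, 1, 0, by simp⟩
    · exact mem_lattice.2 ⟨0, 0, 1, by simp⟩
  · rintro ⟨h₁, h₂, h₃⟩ ⟨x, y, z⟩ h
    obtain ⟨i, j, k, rfl, rfl, rfl⟩ := mem_lattice.1 h
    convert L.add_mem (L.add_mem (L.smul_mem i h₁) (L.smul_mem j h₂)) (L.smul_mem k h₃) using 1
    simp

theorem lattice_sub_trd (ϖ : O) (a b c : ℕ) (u v w m n : O) :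
    lattice ϖ a b c u (v - m * ϖ ^ c) (w - n * ϖ ^ c) = lattice ϖ a b c u v w := by
  apply le_antisymm <;> rw [lattice_le_iff] <;> simp only [mem_lattice]
  · exact ⟨⟨1, 0, -m, by simp, by simp, by ring⟩, ⟨0, 1, -n, by simp, by simp, by ring⟩,
      ⟨0, 0, 1, by simp, by simp, by ring⟩⟩
  · exact ⟨⟨1, 0, m, by simp, by simp, by ring⟩, ⟨0, 1, n, by simp, by simp, by ring⟩,
      ⟨0, 0, 1, by simp, by simp, by ring⟩⟩

theorem lattice_sub_snd (ϖ : O) (a b c : ℕ) (u v w m : O) :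
    lattice ϖ a b c (u - m * ϖ ^ b) (v - m * w) w = lattice ϖ a b c u v w := by
  apply le_antisymm <;> rw [lattice_le_iff] <;> simp only [mem_lattice]
  · exact ⟨⟨1, -m, 0, by simp, by ring, by ring⟩, ⟨0, 1, 0, by simp, by simp, by ring⟩,
      ⟨0, 0, 1, by simp, by simp, by ring⟩⟩
  · exact ⟨⟨1, m, 0, by simp, by ring, by ring⟩, ⟨0, 1, 0, by simp, by simp, by ring⟩,
      ⟨0, 0, 1, by simp, by simp, by ring⟩⟩

/-- In the coordinates with respect to `1, X, X (X - α)`, multiplication by `X` on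
`O[X] / X (X - α) (X - β)`. -/
def shift (α β : O) : (O × O × O) →ₗ[O] (O × O × O) where
  toFun x := (0, x.1 + α * x.2.1, x.2.1 + β * x.2.2)
  map_add' x y := by
    ext <;> simp <;> ring
  map_smul' r x := by
    ext <;> simp <;> ring

@[simp] theorem shift_apply (α β x y z : O) :
    shift α β (x, y, z) = (0, x + α * y, y + β * z) := rfl

/-- Submodules that are stable under multiplication by `X`. -/
def Stable (α β : O) (L : Submodule O (O × O × O)) : Prop :=
  L ≤ L.comap (shift α β)

theorem exists_sub_out_eq (ϖ : O) {n : ℕ} (x : O) :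
    ∃ k, x - (Ideal.Quotient.mk (Ideal.span {ϖ ^ n}) x).out = k * ϖ ^ n := by
  have : Ideal.Quotient.mk (Ideal.span {ϖ ^ n}) x =
    Ideal.Quotient.mk _ (Ideal.Quotient.mk (Ideal.span {ϖ ^ n}) x).out :=
      (Ideal.Quotient.mk_out _).symm
  rw [Ideal.Quotient.eq, Ideal.mem_span_singleton] at this
  obtain ⟨k, hk⟩ := this
  exact ⟨k, by rw [hk, mul_comm]⟩

variable [IsDomain O]

/-- It suffices to shift the three rows. The shifts of the first two have first coordinate `0`, so
they must combine the last two rows: `k` is the multiplier of the second row for the first shift,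
and `α` is forced for the second. The third row is only scaled by `β`, which costs no condition. -/
theorem stable_lattice_iff {ϖ : O} (hϖ : ϖ ≠ 0) {α β : O} {a b c : ℕ} {u v w : O} :
    Stable α β (lattice ϖ a b c u v w) ↔ ∃ k, ϖ ^ a + α * u = k * ϖ ^ b ∧
      ϖ ^ c ∣ u + β * v - k * w ∧ ϖ ^ c ∣ ϖ ^ b + (β - α) * w := by
  have hp (n : ℕ) : ϖ ^ n ≠ 0 := pow_ne_zero n hϖ
  rw [Stable, lattice_le_iff]
  simp only [Submodule.mem_comap, shift_apply, mem_lattice]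
  constructor
  · rintro ⟨⟨i, k, n, h₁, h₂, h₃⟩, ⟨i', k', n', h₁', h₂', h₃'⟩, -⟩
    obtain rfl : i = 0 := by simpa [hp] using h₁.symm
    obtain rfl : i' = 0 := by simpa [hp] using h₁'.symm
    have hk : k' = α := by
      apply mul_right_cancel₀ (hp b)
      linear_combination -h₂'
    refine ⟨k, by linear_combination h₂, ⟨n, by linear_combination h₃⟩,
      ⟨n', by rw [hk] at h₃'; linear_combination h₃'⟩⟩
  · rintro ⟨k, h₁, ⟨m, h₂⟩, ⟨n, h₃⟩⟩
    exact ⟨⟨0, k, m, by simp, by linear_combination h₁, by linear_combination h₂⟩,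
      ⟨0, α, n, by simp, by ring, by linear_combination h₃⟩,
      ⟨0, 0, β, by simp, by ring, by ring⟩⟩

theorem pow_inj_of_dvd {ϖ : O} (hϖ : Irreducible ϖ) {a b : ℕ} (h₁ : ϖ ^ a ∣ ϖ ^ b)
    (h₂ : ϖ ^ b ∣ ϖ ^ a) : a = b :=
  le_antisymm ((pow_dvd_pow_iff hϖ.ne_zero hϖ.not_isUnit).1 h₁)
    ((pow_dvd_pow_iff hϖ.ne_zero hϖ.not_isUnit).1 h₂)

theorem dvd_of_lattice_le {ϖ : O} (hϖ : ϖ ≠ 0) {a b c a' b' c' : ℕ} {u v w u' v' w' : O}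
    (h : lattice ϖ a b c u v w ≤ lattice ϖ a' b' c' u' v' w') :
    ϖ ^ a' ∣ ϖ ^ a ∧ ϖ ^ b' ∣ ϖ ^ b ∧ ϖ ^ c' ∣ ϖ ^ c := by
  have hp (n : ℕ) : ϖ ^ n ≠ 0 := pow_ne_zero n hϖ
  rw [lattice_le_iff] at h
  simp only [mem_lattice] at h
  obtain ⟨⟨i, j, k, h₁, h₂, h₃⟩, ⟨i', j', k', h₁', h₂', h₃'⟩, i'', j'', k'', h₁'', h₂'', h₃''⟩ := h
  obtain rfl : i' = 0 := by simpa [hp] using h₁'.symm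
  obtain rfl : i'' = 0 := by simpa [hp] using h₁''.symm
  obtain rfl : j'' = 0 := by simpa [hp] using h₂''.symm
  exact ⟨⟨i, by linear_combination h₁⟩, ⟨j', by linear_combination h₂'⟩,
    ⟨k'', by linear_combination h₃''⟩⟩

theorem exponents_eq_of_lattice_eq {ϖ : O} (hϖ : Irreducible ϖ) {a b c a' b' c' : ℕ}
    {u v w u' v' w' : O} (h : lattice ϖ a b c u v w = lattice ϖ a' b' c' u' v' w') :
    a = a' ∧ b = b' ∧ c = c' := by
  obtain ⟨h₁, h₂, h₃⟩ := dvd_of_lattice_le hϖ.ne_zero h.le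
  obtain ⟨h₁', h₂', h₃'⟩ := dvd_of_lattice_le hϖ.ne_zero h.ge
  exact ⟨pow_inj_of_dvd hϖ h₁' h₁, pow_inj_of_dvd hϖ h₂' h₂, pow_inj_of_dvd hϖ h₃' h₃⟩

/-- Equal diagonals force a unitriangular change of rows. Changing `u` by a multiple of the second
row also moves `v`, so `v` is comparable only once `u = u'`. -/
theorem dvd_sub_of_lattice_eq {ϖ : O} (hϖ : ϖ ≠ 0) {a b c : ℕ} {u v w u' v' w' : O}
    (h : lattice ϖ a b c u v w = lattice ϖ a b c u' v' w') :
    ϖ ^ c ∣ w - w' ∧ ϖ ^ b ∣ u - u' ∧ (u = u' → ϖ ^ c ∣ v - v') := by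
  have hp (n : ℕ) : ϖ ^ n ≠ 0 := pow_ne_zero n hϖ
  have h := lattice_le_iff.1 h.le
  simp only [mem_lattice] at h
  obtain ⟨⟨i, j, k, h₁, h₂, h₃⟩, ⟨i', j', k', h₁', h₂', h₃'⟩, -⟩ := h
  obtain rfl : i' = 0 := by simpa [hp] using h₁'.symm
  obtain rfl : j' = 1 := mul_right_cancel₀ (hp b) (by linear_combination -h₂')
  obtain rfl : i = 1 := mul_right_cancel₀ (hp a) (by linear_combination -h₁)
  refine ⟨⟨k', by linear_combination h₃'⟩, ⟨j, by linear_combination h₂⟩, ?_⟩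
  rintro rfl
  obtain rfl : j = 0 := mul_right_cancel₀ (hp b) (by linear_combination -h₂)
  exact ⟨k, by linear_combination h₃⟩

/-- Division with remainder by the rows, one coordinate after the other; only the diagonal matters
for the set of remainders. -/
theorem bijective_quotient_lattice (ϖ : O) (hϖ : ϖ ≠ 0) (a b c : ℕ) (u v w : O) :
    Function.Bijective fun x : (O ⧸ Ideal.span {ϖ ^ a}) × (O ⧸ Ideal.span {ϖ ^ b}) ×
      (O ⧸ Ideal.span {ϖ ^ c}) => (Submodule.Quotient.mk (x.1.out, x.2.1.out, x.2.2.out) :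
        (O × O × O) ⧸ lattice ϖ a b c u v w) := by
  have hp (n : ℕ) : ϖ ^ n ≠ 0 := pow_ne_zero n hϖ
  have out_eq {n : ℕ} (x y : O ⧸ Ideal.span {ϖ ^ n}) (k : O) (h : x.out - y.out = k * ϖ ^ n) :
      x = y := by
    rw [← Ideal.Quotient.mk_out x, ← Ideal.Quotient.mk_out y, Ideal.Quotient.eq,
      Ideal.mem_span_singleton]
    exact ⟨k, by rw [h, mul_comm]⟩
  constructor
  · rintro ⟨x, y, z⟩ ⟨x', y', z'⟩ h
    replace h := (Submodule.Quotient.eq _).1 h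
    simp only [Prod.mk_sub_mk, mem_lattice] at h
    obtain ⟨i, j, k, h₁, h₂, h₃⟩ := h
    obtain rfl := out_eq _ _ _ h₁
    obtain rfl : i = 0 := by simpa [hp] using h₁.symm
    rw [zero_mul, zero_add] at h₂ h₃
    obtain rfl := out_eq _ _ _ h₂
    obtain rfl : j = 0 := by simpa [hp] using h₂.symm
    rw [zero_mul, zero_add] at h₃
    obtain rfl := out_eq _ _ _ h₃
    rfl
  · intro q
    obtain ⟨⟨x, y, z⟩, rfl⟩ := Submodule.Quotient.mk_surjective _ q
    obtain ⟨i, hi⟩ := exists_sub_out_eq ϖ (n := a) x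
    obtain ⟨j, hj⟩ := exists_sub_out_eq ϖ (n := b) (y - i * u)
    obtain ⟨k, hk⟩ := exists_sub_out_eq ϖ (n := c) (z - i * v - j * w)
    refine ⟨(Ideal.Quotient.mk _ x, Ideal.Quotient.mk _ (y - i * u),
      Ideal.Quotient.mk _ (z - i * v - j * w)), ?_⟩
    symm
    rw [Submodule.Quotient.eq]
    simp only [Prod.mk_sub_mk, mem_lattice]
    exact ⟨i, j, k, hi, by linear_combination hj, by linear_combination hk⟩

variable [IsDiscreteValuationRing O]

/-- By pigeonhole two of the `ϖ ^ n • e` agree modulo `L`, so the image of `L ⊓ K` under `f` is a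
nonzero ideal of a discrete valuation ring. Its generator is a diagonal entry of the Hermite form.
-/
theorem exists_pow_mem_iff {ϖ : O} (hϖ : Irreducible ϖ) {M : Type*} [AddCommGroup M] [Module O M]
    (L : Submodule O M) [Finite (M ⧸ L)] (K : Submodule O M) (f : M →ₗ[O] O) (e : M) (he : e ∈ K)
    (hf : f e = 1) : ∃ n : ℕ, (∃ m ∈ L ⊓ K, f m = ϖ ^ n) ∧ ∀ m ∈ L ⊓ K, ϖ ^ n ∣ f m := by
  have hne : (L ⊓ K).map f ≠ ⊥ := by
    obtain ⟨i, j, hij, h⟩ := Finite.exists_ne_map_eq_of_infinite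
      fun n : ℕ => (Submodule.Quotient.mk (ϖ ^ n • e) : M ⧸ L)
    rw [Submodule.Quotient.eq, ← sub_smul] at h
    intro h0
    have hm : f ((ϖ ^ i - ϖ ^ j) • e) ∈ (L ⊓ K).map f :=
      Submodule.mem_map_of_mem ⟨h, K.smul_mem _ he⟩
    rw [h0, Submodule.mem_bot, map_smul, hf, smul_eq_mul, mul_one, sub_eq_zero] at hm
    exact hij (pow_injective_of_not_isUnit hϖ.not_isUnit hϖ.ne_zero hm)
  obtain ⟨n, hn⟩ := IsDiscreteValuationRing.ideal_eq_span_pow_irreducible hne hϖ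
  refine ⟨n, ?_, fun m hm => ?_⟩
  · have : ϖ ^ n ∈ (L ⊓ K).map f := by
      rw [hn]
      exact Ideal.mem_span_singleton_self _
    simpa using this
  · have : f m ∈ (L ⊓ K).map f := Submodule.mem_map_of_mem hm
    rwa [hn, Ideal.mem_span_singleton] at this

theorem exists_eq_lattice {ϖ : O} (hϖ : Irreducible ϖ) (L : Submodule O (O × O × O))
    [Finite ((O × O × O) ⧸ L)] : ∃ a b c u v w, L = lattice ϖ a b c u v w := by
  let f₁ : (O × O × O) →ₗ[O] O := LinearMap.fst O O (O × O)
  let f₂ : (O × O × O) →ₗ[O] O := LinearMap.fst O O O ∘ₗ LinearMap.snd O O (O × O)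
  let f₃ : (O × O × O) →ₗ[O] O := LinearMap.snd O O O ∘ₗ LinearMap.snd O O (O × O)
  obtain ⟨a, ⟨⟨x₁, u, v⟩, hm₁, h₁⟩, ha⟩ :=
    exists_pow_mem_iff hϖ L ⊤ f₁ (1, 0, 0) trivial rfl
  obtain ⟨b, ⟨⟨x₂, y₂, w⟩, hm₂, h₂⟩, hb⟩ :=
    exists_pow_mem_iff hϖ L (LinearMap.ker f₁) f₂ (0, 1, 0) rfl rfl
  obtain ⟨c, ⟨⟨x₃, y₃, z₃⟩, hm₃, h₃⟩, hc⟩ :=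
    exists_pow_mem_iff hϖ L (LinearMap.ker f₁ ⊓ LinearMap.ker f₂) f₃ (0, 0, 1) ⟨rfl, rfl⟩ rfl
  obtain rfl : x₁ = ϖ ^ a := h₁
  obtain rfl : x₂ = 0 := hm₂.2
  obtain rfl : y₂ = ϖ ^ b := h₂
  obtain rfl : x₃ = 0 := hm₃.2.1
  obtain rfl : y₃ = 0 := hm₃.2.2
  obtain rfl : z₃ = ϖ ^ c := h₃
  refine ⟨a, b, c, u, v, w, le_antisymm ?_ (lattice_le_iff.2 ⟨hm₁.1, hm₂.1, hm₃.1⟩)⟩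
  rintro ⟨x, y, z⟩ h
  obtain ⟨i, hi⟩ := ha (x, y, z) ⟨h, trivial⟩
  obtain rfl : x = ϖ ^ a * i := hi
  have h' := L.sub_mem h (L.smul_mem i hm₁.1)
  obtain ⟨j, hj⟩ := hb _ ⟨h', by simp [f₁, mul_comm]⟩
  replace hj : y - i * u = ϖ ^ b * j := hj
  have h'' := L.sub_mem h' (L.smul_mem j hm₂.1)
  obtain ⟨k, hk⟩ := hc _ ⟨h'', by simp [f₁, mul_comm], by simp [f₂]; linear_combination hj⟩
  replace hk : z - i * v - j * w = ϖ ^ c * k := hk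
  exact mem_lattice.2 ⟨i, j, k, by ring, by linear_combination hj, by linear_combination hk⟩

theorem natCard_quotient_span_pow {ϖ : O} (hϖ : Irreducible ϖ) (n : ℕ) :
    Nat.card (O ⧸ Ideal.span {ϖ ^ n}) = Nat.card (IsLocalRing.ResidueField O) ^ n := by
  have h := cardQuot_pow_of_prime (P := IsLocalRing.maximalIdeal O)
    (IsDiscreteValuationRing.not_a_field O) (i := n)
  rw [hϖ.maximalIdeal_eq, Ideal.span_singleton_pow] at h
  rw [IsLocalRing.ResidueField, hϖ.maximalIdeal_eq]
  simpa [Submodule.cardQuot_apply] using h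

theorem natCard_quotient_lattice {ϖ : O} (hϖ : Irreducible ϖ) (a b c : ℕ) (u v w : O) :
    Nat.card ((O × O × O) ⧸ lattice ϖ a b c u v w) =
      Nat.card (IsLocalRing.ResidueField O) ^ (a + b + c) := by
  rw [← Nat.card_eq_of_bijective _ (bijective_quotient_lattice ϖ hϖ.ne_zero a b c u v w),
    Nat.card_prod, Nat.card_prod, natCard_quotient_span_pow hϖ, natCard_quotient_span_pow hϖ,
    natCard_quotient_span_pow hϖ, pow_add, pow_add, mul_assoc]

theorem finite_quotient_span_pow {ϖ : O} (hϖ : Irreducible ϖ)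
    [Finite (IsLocalRing.ResidueField O)] (n : ℕ) : Finite (O ⧸ Ideal.span {ϖ ^ n}) := by
  apply Nat.finite_of_card_ne_zero
  rw [natCard_quotient_span_pow hϖ]
  exact pow_ne_zero _ Nat.card_pos.ne'

theorem finite_quotient_lattice {ϖ : O} (hϖ : Irreducible ϖ)
    [Finite (IsLocalRing.ResidueField O)] (a b c : ℕ) (u v w : O) :
    Finite ((O × O × O) ⧸ lattice ϖ a b c u v w) := by
  apply Nat.finite_of_card_ne_zero
  rw [natCard_quotient_lattice hϖ]
  exact pow_ne_zero _ Nat.card_pos.ne'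

end Lattice

/-! ### Counting stable lattices with a given diagonal. -/

section Count

open IsLocalRing

variable {O : Type*} [CommRing O]

/-- The stable lattices whose Hermite normal form has the diagonal `ϖ ^ a, ϖ ^ b, ϖ ^ c`. -/
def stableLattices (ϖ α β : O) (a b c : ℕ) : Set (Submodule O (O × O × O)) :=
  {L | Stable α β L ∧ ∃ u v w, L = lattice ϖ a b c u v w}

theorem lattice_zero_zero (ϖ : O) (a : ℕ) (u v w : O) :
    lattice ϖ a 0 0 u v w = lattice ϖ a 0 0 0 0 0 := by
  rw [← lattice_sub_trd ϖ a 0 0 u v w v w, ← lattice_sub_snd ϖ a 0 0 u _ _ u]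
  simp

theorem lattice_zero (ϖ : O) (a b : ℕ) (u v w : O) :
    lattice ϖ a b 0 u v w = lattice ϖ a b 0 u 0 0 := by
  rw [← lattice_sub_trd ϖ a b 0 u v w v w]
  simp

variable [IsDomain O]

theorem natCard_stableLattices_zero_zero {ϖ : O} (hϖ : ϖ ≠ 0) (α β : O) (a : ℕ) :
    Nat.card (stableLattices ϖ α β a 0 0) = 1 := by
  have : stableLattices ϖ α β a 0 0 = {lattice ϖ a 0 0 0 0 0} := by
    ext L
    simp only [stableLattices, Set.mem_ofPred_eq, Set.mem_singleton_iff]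
    constructor
    · rintro ⟨-, u, v, w, rfl⟩
      exact lattice_zero_zero ϖ a u v w
    · rintro rfl
      exact ⟨(stable_lattice_iff hϖ).2 ⟨ϖ ^ a, by simp⟩, 0, 0, 0, rfl⟩
  rw [this]
  simp

/-- Modulo `ϖ` the first stability condition reads `1 = 0`. -/
theorem stableLattices_zero_succ {ϖ : O} (hϖ : Irreducible ϖ) (A B : O) (b c : ℕ) :
    stableLattices ϖ (ϖ * A) (ϖ * B) 0 (b + 1) c = ∅ := by
  rw [Set.eq_empty_iff_forall_notMem]
  rintro L ⟨h, u, v, w, rfl⟩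
  obtain ⟨k, h, -⟩ := (stable_lattice_iff hϖ.ne_zero).1 h
  exact hϖ.not_isUnit (isUnit_iff_dvd_one.2 ⟨k * ϖ ^ b - A * u, by linear_combination h⟩)

/-- Modulo `ϖ` the last stability condition reads `1 = 0`. -/
theorem stableLattices_mid_zero_succ {ϖ : O} (hϖ : Irreducible ϖ) (A B : O) (a c : ℕ) :
    stableLattices ϖ (ϖ * A) (ϖ * B) a 0 (c + 1) = ∅ := by
  rw [Set.eq_empty_iff_forall_notMem]
  rintro L ⟨h, u, v, w, rfl⟩
  obtain ⟨k, -, -, m, h⟩ := (stable_lattice_iff hϖ.ne_zero).1 h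
  exact hϖ.not_isUnit (isUnit_iff_dvd_one.2 ⟨ϖ ^ c * m - (B - A) * w, by linear_combination h⟩)

variable [IsDiscreteValuationRing O]

/-- A representative of a residue class. -/
noncomputable def rep (s : ResidueField O) : O :=
  Function.surjInv residue_surjective s

@[simp] theorem residue_rep (s : ResidueField O) : residue O (rep s) = s :=
  Function.surjInv_eq _ s

theorem residue_eq_zero_iff_dvd {ϖ : O} (hϖ : Irreducible ϖ) {x : O} :
    residue O x = 0 ↔ ϖ ∣ x := by
  rw [residue_eq_zero_iff, hϖ.maximalIdeal_eq, Ideal.mem_span_singleton]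

theorem exists_eq_rep_add {ϖ : O} (hϖ : Irreducible ϖ) (x : O) :
    ∃ m, x = rep (residue O x) + ϖ * m := by
  have : ϖ ∣ x - rep (residue O x) := by
    rw [← residue_eq_zero_iff_dvd hϖ]
    simp
  obtain ⟨m, hm⟩ := this
  exact ⟨m, by linear_combination hm⟩

theorem eq_of_pow_succ_dvd {ϖ : O} (hϖ : Irreducible ϖ) {n : ℕ} {s t : ResidueField O}
    (C : Oˣ) (x : O) (h : ϖ ^ (n + 1) ∣
      ↑C⁻¹ * (ϖ ^ n * rep s - x) - ↑C⁻¹ * (ϖ ^ n * rep t - x)) : s = t := by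
  obtain ⟨m, hm⟩ := h
  have : ϖ ∣ rep s - rep t := by
    refine ⟨C * m, mul_left_cancel₀ (pow_ne_zero n hϖ.ne_zero) ?_⟩
    linear_combination (C : O) * hm - (ϖ ^ n * rep s - ϖ ^ n * rep t) * C.mul_inv
  rw [← residue_eq_zero_iff_dvd hϖ, map_sub, sub_eq_zero] at this
  simpa using this

theorem natCard_stableLattices_succ_succ_zero {ϖ : O} (hϖ : Irreducible ϖ) (A : Oˣ) (β : O)
    (a b : ℕ) : Nat.card (stableLattices ϖ (ϖ * A) β (a + 1) (b + 1) 0) =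
      Nat.card (ResidueField O) := by
  symm
  let U (s : ResidueField O) : O := ↑A⁻¹ * (ϖ ^ b * rep s - ϖ ^ a)
  have hU (s) : ϖ ^ (a + 1) + ϖ * A * U s = rep s * ϖ ^ (b + 1) := by
    simp only [U]
    linear_combination (ϖ * (ϖ ^ b * rep s - ϖ ^ a)) * A.mul_inv
  refine Nat.card_eq_of_bijective (fun s : ResidueField O =>
    (⟨lattice ϖ (a + 1) (b + 1) 0 (U s) 0 0,
      (stable_lattice_iff hϖ.ne_zero).2 ⟨rep s, hU s, by simp⟩, U s, 0, 0, rfl⟩ :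
      stableLattices ϖ (ϖ * A) β (a + 1) (b + 1) 0)) ⟨fun s t h => ?_, ?_⟩
  · exact eq_of_pow_succ_dvd hϖ A _ (dvd_sub_of_lattice_eq hϖ.ne_zero (congrArg Subtype.val h)).2.1
  · rintro ⟨L, hL, u, v, w, rfl⟩
    obtain ⟨k, hk, -⟩ := (stable_lattice_iff hϖ.ne_zero).1 hL
    obtain ⟨m, hm⟩ := exists_eq_rep_add hϖ k
    refine ⟨residue O k, Subtype.ext ?_⟩
    have : U (residue O k) = u - (↑A⁻¹ * m) * ϖ ^ (b + 1) := by
      apply mul_left_cancel₀ (mul_ne_zero hϖ.ne_zero A.ne_zero)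
      linear_combination hU (residue O k) - hk - ϖ ^ (b + 1) * hm +
        ϖ * m * ϖ ^ (b + 1) * A.mul_inv
    simp only [this]
    rw [← lattice_sub_snd ϖ _ _ 0 u v w (↑A⁻¹ * m)]
    exact (lattice_zero ..).symm

/-- The pairs of residues that parametrize, up to one further free residue, the stable lattices
whose diagonal is `ϖ ^ (a + 1), ϖ ^ (b + 1), ϖ ^ (c + 1)`. -/
def residuePairs {k : Type*} [Field k] (A B : k) (a b c : ℕ) : Set (k × k) :=
  {x | B * x.1 * 0 ^ b - (B - A) * 0 ^ a - A * x.1 * x.2 * 0 ^ c = 0}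

theorem natCard_stableLattices_succ {ϖ : O} (hϖ : Irreducible ϖ) (A B D : Oˣ)
    (hD : (D : O) = B - A) (a b c : ℕ) :
    Nat.card (stableLattices ϖ (ϖ * A) (ϖ * B) (a + 1) (b + 1) (c + 1)) =
      Nat.card (ResidueField O) *
        Nat.card (residuePairs (residue O A) (residue O B) a b c) := by
  rw [← Nat.card_prod]
  symm
  have hϖ0 : residue O ϖ = 0 := (residue_eq_zero_iff_dvd hϖ).2 dvd_rfl
  -- `U s` and `W t` solve the first and third stability conditions after division by `ϖ`. Changing
  -- `s` or `t` by a multiple of `ϖ` changes them by a multiple of the diagonal entry `ϖ ^ (b + 1)`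
  -- or `ϖ ^ (c + 1)`, so only residues count.
  let U (s : O) : O := ↑A⁻¹ * (ϖ ^ b * s - ϖ ^ a)
  let W (t : O) : O := ↑D⁻¹ * (ϖ ^ c * t - ϖ ^ b)
  have hU (s) : ϖ ^ a + A * U s = s * ϖ ^ b := by
    simp only [U]
    linear_combination (ϖ ^ b * s - ϖ ^ a) * A.mul_inv
  have hW (t) : ϖ ^ b + D * W t = ϖ ^ c * t := by
    simp only [W]
    linear_combination (ϖ ^ c * t - ϖ ^ b) * D.mul_inv
  have hdvd (s t : O) : ϖ ∣ U s - s * W t ↔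
      (residue O s, residue O t) ∈ residuePairs (residue O A) (residue O B) a b c := by
    -- The units are cleared using `A + D = B`. Modulo `ϖ` each `ϖ ^ n` becomes `0 ^ n`, which
    -- survives only for `n = 0`.
    have key : (A : O) * D * (U s - s * W t) =
        B * s * ϖ ^ b - (B - A) * ϖ ^ a - A * s * t * ϖ ^ c := by
      linear_combination (D : O) * hU s - A * s * hW t + (s * ϖ ^ b - ϖ ^ a) * hD
    have : ϖ ∣ U s - s * W t ↔ ϖ ∣ (A : O) * D * (U s - s * W t) := by
      rw [mul_assoc, Units.dvd_mul_left, Units.dvd_mul_left]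
    rw [this, key, ← residue_eq_zero_iff_dvd hϖ, residuePairs, Set.mem_ofPred_eq]
    simp [hϖ0]
  have hQ (x : residuePairs (residue O A) (residue O B) a b c) :
      ∃ q, U (rep x.1.1) - rep x.1.1 * W (rep x.1.2) = ϖ * q := by
    apply (hdvd _ _).2
    simp
  choose Q hQ using hQ
  -- The middle condition, divided by `ϖ`, fixes `v` only modulo `ϖ ^ c`, while `v` matters modulo
  -- `ϖ ^ (c + 1)`: this is the free residue `r`.
  let V (r : O) (x : residuePairs (residue O A) (residue O B) a b c) : O :=
    ↑B⁻¹ * (ϖ ^ c * r - Q x)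
  have hV (r x) : U (rep x.1.1) + ϖ * B * V r x - rep x.1.1 * W (rep x.1.2) =
      ϖ ^ (c + 1) * r := by
    simp only [V]
    linear_combination ϖ * (ϖ ^ c * r - Q x) * B.mul_inv + hQ x
  refine Nat.card_eq_of_bijective (fun y : ResidueField O × residuePairs _ _ a b c =>
    (⟨lattice ϖ (a + 1) (b + 1) (c + 1) (U (rep y.2.1.1)) (V (rep y.1) y.2) (W (rep y.2.1.2)),
      (stable_lattice_iff hϖ.ne_zero).2 ⟨rep y.2.1.1, by linear_combination ϖ * hU (rep y.2.1.1),
        ⟨rep y.1, hV _ _⟩, ⟨rep y.2.1.2, by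
          linear_combination ϖ * hW (rep y.2.1.2) - ϖ * W (rep y.2.1.2) * hD⟩⟩, _, _, _, rfl⟩ :
      stableLattices ϖ (ϖ * A) (ϖ * B) (a + 1) (b + 1) (c + 1))) ⟨?_, ?_⟩
  · rintro ⟨r, ⟨⟨s, t⟩, hx⟩⟩ ⟨r', ⟨⟨s', t'⟩, hx'⟩⟩ h
    obtain ⟨h₁, h₂, h₃⟩ := dvd_sub_of_lattice_eq hϖ.ne_zero (congrArg Subtype.val h)
    obtain rfl := eq_of_pow_succ_dvd hϖ D _ h₁
    obtain rfl := eq_of_pow_succ_dvd hϖ A _ h₂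
    obtain rfl := eq_of_pow_succ_dvd hϖ B _ (h₃ rfl)
    rfl
  · rintro ⟨L, hL, u, v, w, rfl⟩
    obtain ⟨s, hs, -, t, ht⟩ := (stable_lattice_iff hϖ.ne_zero).1 hL
    obtain ⟨m, hm⟩ := exists_eq_rep_add hϖ s
    obtain ⟨n, hn⟩ := exists_eq_rep_add hϖ t
    have hu : U (rep (residue O s)) = u - (↑A⁻¹ * m) * ϖ ^ (b + 1) := by
      apply mul_left_cancel₀ (mul_ne_zero hϖ.ne_zero A.ne_zero)
      linear_combination ϖ * hU (rep (residue O s)) - hs - ϖ ^ (b + 1) * hm +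
        ϖ * m * ϖ ^ (b + 1) * A.mul_inv
    have hw : W (rep (residue O t)) = w - (↑D⁻¹ * n) * ϖ ^ (c + 1) := by
      apply mul_left_cancel₀ (mul_ne_zero hϖ.ne_zero D.ne_zero)
      linear_combination ϖ * hW (rep (residue O t)) - ht - ϖ ^ (c + 1) * hn +
        ϖ * n * ϖ ^ (c + 1) * D.mul_inv - ϖ * w * hD
    -- Row operations make `u` and `w` canonical before `v` is treated, since the reduction of `u`
    -- alters `v`.
    have hL' : lattice ϖ (a + 1) (b + 1) (c + 1) u v w = lattice ϖ (a + 1) (b + 1) (c + 1)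
        (U (rep (residue O s))) (v - ↑A⁻¹ * m * W (rep (residue O t)))
        (W (rep (residue O t))) := by
      rw [hu, lattice_sub_snd, hw]
      simpa using (lattice_sub_trd ϖ (a + 1) (b + 1) (c + 1) u v w 0 (↑D⁻¹ * n)).symm
    rw [hL'] at hL
    set v' := v - ↑A⁻¹ * m * W (rep (residue O t)) with hv'
    obtain ⟨s', hs', ⟨r, hr⟩, -⟩ := (stable_lattice_iff hϖ.ne_zero).1 hL
    obtain rfl : s' = rep (residue O s) := by
      apply mul_right_cancel₀ (pow_ne_zero (b + 1) hϖ.ne_zero)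
      linear_combination ϖ * hU (rep (residue O s)) - hs'
    have hx : (residue O s, residue O t) ∈ residuePairs (residue O A) (residue O B) a b c := by
      have := (hdvd (rep (residue O s)) (rep (residue O t))).1
        ⟨ϖ ^ c * r - B * v', by linear_combination hr⟩
      simpa using this
    obtain ⟨l, hl⟩ := exists_eq_rep_add hϖ r
    refine ⟨(residue O r, ⟨_, hx⟩), Subtype.ext ?_⟩
    have hv : V (rep (residue O r)) ⟨_, hx⟩ = v' - (↑B⁻¹ * l) * ϖ ^ (c + 1) := by
      apply mul_left_cancel₀ (mul_ne_zero hϖ.ne_zero B.ne_zero)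
      linear_combination hV (rep (residue O r)) ⟨_, hx⟩ - hr - ϖ ^ (c + 1) * hl +
        ϖ * l * ϖ ^ (c + 1) * B.mul_inv
    simp only [hv]
    rw [hL']
    simpa using lattice_sub_trd ϖ (a + 1) (b + 1) (c + 1) (U (rep (residue O s))) v'
      (W (rep (residue O t))) (↑B⁻¹ * l) 0

theorem natCard_residuePairs {k : Type*} [Field k] [Finite k] {A B : k} (hA : A ≠ 0)
    (hB : B ≠ 0) (hAB : B - A ≠ 0) (a b c : ℕ) : (Nat.card (residuePairs A B a b c) : ℤ) =
      if c = 0 then if a = 0 then (Nat.card k : ℤ) - 1 else 2 * Nat.card k - 1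
      else if b = 0 then (Nat.card k : ℤ) else if a = 0 then 0 else (Nat.card k : ℤ) ^ 2 := by
  have hk : 1 ≤ Nat.card k := Nat.card_pos
  rw [Nat.card_coe_set_eq]
  by_cases hc : c = 0
  · let τ : k := B * 0 ^ b / A
    have hτ (t : k) : B * 0 ^ b - A * t = 0 ↔ t = τ := by
      rw [eq_div_iff hA, sub_eq_zero, eq_comm, mul_comm]
    by_cases ha : a = 0
    -- Here the equation is `s * (B * 0 ^ b - A * t) = B - A` with nonzero right side: one `s` for
    -- each `t` other than `τ`.
    · have : residuePairs A B a b c =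
          (fun t => ((B - A) / (B * 0 ^ b - A * t), t)) '' {τ}ᶜ := by
        ext ⟨s, t⟩
        simp only [residuePairs, Set.mem_ofPred_eq, ha, hc, pow_zero, mul_one, Set.mem_image,
          Set.mem_compl_iff, Set.mem_singleton_iff, Prod.mk.injEq]
        constructor
        · intro h
          have ht : B * 0 ^ b - A * t ≠ 0 := fun h0 => hAB (by linear_combination s * h0 - h)
          refine ⟨t, mt (hτ t).2 ht, ?_, rfl⟩
          rw [div_eq_iff ht]
          linear_combination -h
        · rintro ⟨t, ht, rfl, rfl⟩
          have := mt (hτ t).1 ht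
          field_simp
          ring
      rw [this, Set.ncard_image_of_injective _ fun x y h => congrArg Prod.snd h, Set.ncard_compl,
        Set.ncard_singleton, if_pos hc, if_pos ha]
      push_cast [hk]
      rfl
    -- The right side now vanishes, leaving two lines that meet in one point.
    · have : residuePairs A B a b c = {0} ×ˢ Set.univ ∪ Set.univ ×ˢ {τ} := by
        ext ⟨s, t⟩
        have : B * s * 0 ^ b - A * s * t = s * (B * 0 ^ b - A * t) := by ring
        simp [residuePairs, ha, hc, this, hτ]
      have h := Set.ncard_union_add_ncard_inter ({0} ×ˢ Set.univ : Set (k × k))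
        (Set.univ ×ˢ {τ}) (Set.toFinite _) (Set.toFinite _)
      have hi : ({0} ×ˢ Set.univ : Set (k × k)) ∩ (Set.univ ×ˢ {τ}) = {(0, τ)} := by
        ext ⟨s, t⟩
        simp
      rw [hi, Set.ncard_prod, Set.ncard_prod] at h
      simp only [Set.ncard_singleton, Set.ncard_univ] at h
      rw [this, if_pos hc, if_neg ha]
      omega
  · rw [if_neg hc]
    by_cases hb : b = 0
    · have : residuePairs A B a b c = {(B - A) * 0 ^ a / B} ×ˢ Set.univ := by
        ext ⟨s, t⟩
        simp [residuePairs, hb, hc, eq_div_iff hB, sub_eq_zero, mul_comm]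
      rw [this, if_pos hb, Set.ncard_prod]
      simp [Set.ncard_univ]
    · by_cases ha : a = 0
      · have : residuePairs A B a b c = ∅ := by
          ext ⟨s, t⟩
          simpa [residuePairs, hb, hc, ha, sub_eq_zero, eq_comm] using hAB
        rw [this, if_neg hb, if_pos ha]
        simp
      · have : residuePairs A B a b c = Set.univ := by
          ext ⟨s, t⟩
          simp [residuePairs, hb, hc, ha]
        rw [this, if_neg hb, if_neg ha]
        simp [Set.ncard_univ, Nat.card_prod, sq]

/-- The number of stable lattices whose diagonal is `ϖ ^ a, ϖ ^ b, ϖ ^ c`, where `q` is the number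
of elements of the residue field. -/
def latticeCount (q : ℤ) : ℕ → ℕ → ℕ → ℤ
  | _, 0, 0 => 1
  | _, 0, _ + 1 => 0
  | 0, _ + 1, _ => 0
  | _ + 1, _ + 1, 0 => q
  | a + 1, b + 1, c + 1 => q * if c = 0 then if a = 0 then q - 1 else 2 * q - 1
      else if b = 0 then q else if a = 0 then 0 else q ^ 2

theorem natCard_stableLattices [Finite (ResidueField O)] {ϖ : O} (hϖ : Irreducible ϖ)
    (A B D : Oˣ) (hD : (D : O) = B - A) (a b c : ℕ) :
    (Nat.card (stableLattices ϖ (ϖ * A) (ϖ * B) a b c) : ℤ) =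
      latticeCount (Nat.card (ResidueField O)) a b c := by
  have hres (C : Oˣ) : residue O (C : O) ≠ 0 := residue_ne_zero_iff_isUnit _ |>.2 C.isUnit
  match a, b, c with
  | _, 0, 0 => simp [natCard_stableLattices_zero_zero hϖ.ne_zero, latticeCount]
  | _, 0, _ + 1 => simp [stableLattices_mid_zero_succ hϖ, latticeCount]
  | 0, _ + 1, _ => simp [stableLattices_zero_succ hϖ, latticeCount]
  | _ + 1, _ + 1, 0 => simp [natCard_stableLattices_succ_succ_zero hϖ, latticeCount]
  | a + 1, b + 1, c + 1 =>
    rw [natCard_stableLattices_succ hϖ A B D hD, Nat.cast_mul, natCard_residuePairs (hres A)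
      (hres B) (by rw [← map_sub, ← hD]; exact hres D), latticeCount]

theorem finite_stableLattices [Finite (ResidueField O)] {ϖ : O} (hϖ : Irreducible ϖ)
    (α β : O) (a b c : ℕ) : (stableLattices ϖ α β a b c).Finite := by
  have := finite_quotient_span_pow hϖ
  refine (Set.finite_range fun x : (O ⧸ Ideal.span {ϖ ^ b}) × (O ⧸ Ideal.span {ϖ ^ c}) ×
    (O ⧸ Ideal.span {ϖ ^ c}) => lattice ϖ a b c x.1.out x.2.1.out x.2.2.out).subset ?_
  rintro L ⟨-, u, v, w, rfl⟩
  obtain ⟨i, hi⟩ := exists_sub_out_eq ϖ (n := b) u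
  obtain ⟨j, hj⟩ := exists_sub_out_eq ϖ (n := c) (v - i * w)
  obtain ⟨k, hk⟩ := exists_sub_out_eq ϖ (n := c) w
  refine ⟨(Ideal.Quotient.mk _ u, Ideal.Quotient.mk _ (v - i * w), Ideal.Quotient.mk _ w), ?_⟩
  rw [← lattice_sub_snd ϖ a b c u v w i, ← lattice_sub_trd ϖ a b c _ _ w j k, ← hi, ← hj, ← hk]
  simp

end Count

/-! ### Ideals of the cubic ring as stable lattices. -/

section Coordinates

open Polynomial

variable {O : Type*} [CommRing O]

/-- The polynomial `X (X - α) (X - β)`. -/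
noncomputable def cubicPoly (α β : O) : O[X] := X * (X - C α) * (X - C β)

theorem monic_cubicPoly (α β : O) : (cubicPoly α β).Monic :=
  (monic_X.mul (monic_X_sub_C α)).mul (monic_X_sub_C β)

theorem natDegree_cubicPoly [Nontrivial O] (α β : O) : (cubicPoly α β).natDegree = 3 := by
  rw [cubicPoly, (monic_X.mul (monic_X_sub_C α)).natDegree_mul (monic_X_sub_C β),
    monic_X.natDegree_mul (monic_X_sub_C α), natDegree_X, natDegree_X_sub_C, natDegree_X_sub_C]

/-- The polynomial with coordinates `x, y, z` with respect to `1, X, X (X - α)`. -/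
noncomputable def polyOfCoords (α : O) : (O × O × O) →ₗ[O] O[X] where
  toFun x := C x.1 + C x.2.1 * X + C x.2.2 * (X * (X - C α))
  map_add' x y := by
    simp
    ring
  map_smul' r x := by
    simp [smul_eq_C_mul]
    ring

/-- The element of `O[X] / X (X - α) (X - β)` with coordinates `x, y, z` with respect to
`1, X, X (X - α)`. -/
noncomputable def ofCoords (α β : O) : (O × O × O) →ₗ[O] AdjoinRoot (cubicPoly α β) :=
  (AdjoinRoot.mkₐ (cubicPoly α β)).toLinearMap ∘ₗ polyOfCoords α

theorem ofCoords_apply (α β : O) (x : O × O × O) :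
    ofCoords α β x = AdjoinRoot.mk (cubicPoly α β) (polyOfCoords α x) := rfl

theorem ofCoords_shift (α β : O) (x : O × O × O) :
    ofCoords α β (shift α β x) = AdjoinRoot.root (cubicPoly α β) * ofCoords α β x := by
  rw [ofCoords_apply, ofCoords_apply, ← AdjoinRoot.mk_X, ← map_mul, AdjoinRoot.mk_eq_mk]
  refine ⟨-C x.2.2, ?_⟩
  simp only [polyOfCoords, cubicPoly, shift, LinearMap.coe_mk, AddHom.coe_mk, C_add, C_mul, C_0]
  ring

theorem injective_ofCoords (α β : O) : Function.Injective (ofCoords α β) := by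
  rw [← LinearMap.ker_eq_bot, LinearMap.ker_eq_bot']
  rintro ⟨x, y, z⟩ h
  nontriviality O
  rw [ofCoords_apply, AdjoinRoot.mk_eq_zero] at h
  have hf : polyOfCoords α (x, y, z) = C z * X ^ 2 + C (y - α * z) * X + C x := by
    simp only [polyOfCoords, LinearMap.coe_mk, AddHom.coe_mk, C_sub, C_mul]
    ring
  rw [hf] at h
  have h0 : C z * X ^ 2 + C (y - α * z) * X + C x = 0 := by_contra fun h0 => (monic_cubicPoly α β).not_dvd_of_degree_lt h0 (by
    rw [degree_eq_natDegree (monic_cubicPoly α β).ne_zero, natDegree_cubicPoly]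
    exact degree_quadratic_lt) h
  have h₀ := congrArg (coeff · 0) h0
  have h₁ := congrArg (coeff · 1) h0
  have h₂ := congrArg (coeff · 2) h0
  simp [coeff_X, coeff_C] at h₀ h₁ h₂
  simp_all

theorem surjective_ofCoords (α β : O) : Function.Surjective (ofCoords α β) := by
  intro r
  induction r using AdjoinRoot.induction_on with
  | ih f =>
    change AdjoinRoot.mk _ f ∈ LinearMap.range (ofCoords α β)
    induction f using Polynomial.induction_on with
    | C a => exact ⟨(a, 0, 0), by simp [ofCoords_apply, polyOfCoords]⟩
    | add f g hf hg => rw [map_add]; exact Submodule.add_mem _ hf hg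
    | monomial n a h =>
      obtain ⟨x, hx⟩ := h
      refine ⟨shift α β x, ?_⟩
      rw [ofCoords_shift, hx, ← AdjoinRoot.mk_X, ← map_mul]
      ring_nf

/-- The ring `O[X] / X (X - α) (X - β)` in coordinates. -/
noncomputable def coordsEquiv (α β : O) : (O × O × O) ≃ₗ[O] AdjoinRoot (cubicPoly α β) :=
  LinearEquiv.ofBijective (ofCoords α β) ⟨injective_ofCoords α β, surjective_ofCoords α β⟩

theorem coordsEquiv_shift (α β : O) (x : O × O × O) :
    coordsEquiv α β (shift α β x) = AdjoinRoot.root (cubicPoly α β) * coordsEquiv α β x :=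
  ofCoords_shift α β x

/-- The lattice of coordinates of the elements of an ideal. -/
noncomputable def latticeOfIdeal (α β : O) (I : Ideal (AdjoinRoot (cubicPoly α β))) :
    Submodule O (O × O × O) :=
  (I.restrictScalars O).comap (coordsEquiv α β : (O × O × O) →ₗ[O] _)

theorem mem_latticeOfIdeal {α β : O} {I : Ideal (AdjoinRoot (cubicPoly α β))} {x : O × O × O} :
    x ∈ latticeOfIdeal α β I ↔ coordsEquiv α β x ∈ I := Iff.rfl

theorem injective_latticeOfIdeal (α β : O) : Function.Injective (latticeOfIdeal α β) := by
  intro I J h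
  ext r
  obtain ⟨x, rfl⟩ := (coordsEquiv α β).surjective r
  rw [← mem_latticeOfIdeal, h, mem_latticeOfIdeal]

theorem stable_latticeOfIdeal (α β : O) (I : Ideal (AdjoinRoot (cubicPoly α β))) :
    Stable α β (latticeOfIdeal α β I) := by
  intro x hx
  rw [Submodule.mem_comap, mem_latticeOfIdeal, coordsEquiv_shift]
  exact I.mul_mem_left _ hx

theorem exists_latticeOfIdeal_eq {α β : O} {L : Submodule O (O × O × O)} (hL : Stable α β L) :
    ∃ I, latticeOfIdeal α β I = L := by
  let I : Ideal (AdjoinRoot (cubicPoly α β)) :=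
    { L.map (coordsEquiv α β : (O × O × O) →ₗ[O] _) with
      smul_mem' := by
        intro r
        induction r using AdjoinRoot.induction_on with
        | ih f =>
          rintro _ ⟨x, hx, rfl⟩
          change AdjoinRoot.mk _ f * coordsEquiv α β x ∈
            L.map (coordsEquiv α β : (O × O × O) →ₗ[O] _)
          -- `x` must vary: raising the degree of a monomial uses the hypothesis at `shift α β x`.
          induction f using Polynomial.induction_on generalizing x with
          | C a =>
            refine ⟨a • x, L.smul_mem a hx, ?_⟩
            rw [LinearEquiv.coe_coe, map_smul, Algebra.smul_def, AdjoinRoot.mk_C]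
            rfl
          | add f g hf hg =>
            rw [map_add, add_mul]
            exact Submodule.add_mem _ (hf x hx) (hg x hx)
          | monomial n a h =>
            have := h (shift α β x) (hL hx)
            rwa [coordsEquiv_shift, ← mul_assoc, ← AdjoinRoot.mk_X, ← map_mul, mul_assoc,
              ← pow_succ] at this }
  refine ⟨I, ?_⟩
  ext x
  rw [mem_latticeOfIdeal]
  constructor
  · rintro ⟨y, hy, h⟩
    rwa [← (coordsEquiv α β).injective h]
  · exact fun h => ⟨x, h, rfl⟩

/-- The quotient by an ideal in coordinates. -/
noncomputable def quotientEquiv (α β : O) (I : Ideal (AdjoinRoot (cubicPoly α β))) :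
    ((O × O × O) ⧸ latticeOfIdeal α β I) ≃ₗ[O] AdjoinRoot (cubicPoly α β) ⧸ I :=
  Submodule.Quotient.equiv _ (I.restrictScalars O) (coordsEquiv α β)
      (Submodule.map_comap_eq_of_surjective (coordsEquiv α β).surjective _) ≪≫ₗ
    Submodule.Quotient.restrictScalarsEquiv O I

variable [IsDomain O] [IsDiscreteValuationRing O] [Finite (IsLocalRing.ResidueField O)]

/-- The exponents of the diagonal of the Hermite normal form attached to an ideal. -/
theorem exists_exponents {ϖ : O} (hϖ : Irreducible ϖ) (α β : O) :
    ∃ e : {I : Ideal (AdjoinRoot (cubicPoly α β)) // Finite (AdjoinRoot (cubicPoly α β) ⧸ I)} →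
        ℕ × ℕ × ℕ,
      (∀ I, Nat.card (AdjoinRoot (cubicPoly α β) ⧸ I.1) =
        Nat.card (IsLocalRing.ResidueField O) ^ ((e I).1 + (e I).2.1 + (e I).2.2)) ∧
      ∀ a b c, Nonempty ({I // e I = (a, b, c)} ≃ stableLattices ϖ α β a b c) := by
  have hex (I : {I : Ideal (AdjoinRoot (cubicPoly α β)) //
      Finite (AdjoinRoot (cubicPoly α β) ⧸ I)}) : ∃ e : ℕ × ℕ × ℕ, ∃ u v w,
      latticeOfIdeal α β I.1 = lattice ϖ e.1 e.2.1 e.2.2 u v w := by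
    have := I.2
    have := Finite.of_equiv _ (quotientEquiv α β I.1).toEquiv.symm
    obtain ⟨a, b, c, h⟩ := exists_eq_lattice hϖ (latticeOfIdeal α β I.1)
    exact ⟨(a, b, c), h⟩
  choose e u v w he using hex
  refine ⟨e, fun I => ?_, fun a b c => ⟨Equiv.ofBijective (fun I => ⟨latticeOfIdeal α β I.1.1,
    stable_latticeOfIdeal α β _, u I.1, v I.1, w I.1, ?_⟩) ⟨?_, ?_⟩⟩⟩
  · rw [← natCard_quotient_lattice hϖ _ _ _ (u I) (v I) (w I), ← he I]
    exact (Nat.card_congr (quotientEquiv α β I.1).toEquiv).symm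
  · rw [he, I.2]
  · intro I J h
    exact Subtype.ext (Subtype.ext (injective_latticeOfIdeal α β (congrArg Subtype.val h)))
  · rintro ⟨L, hL, u', v', w', rfl⟩
    obtain ⟨I, hI⟩ := exists_latticeOfIdeal_eq hL
    have hfin : Finite (AdjoinRoot (cubicPoly α β) ⧸ I) := by
      have := finite_quotient_lattice hϖ a b c u' v' w'
      rw [← hI] at this
      exact Finite.of_equiv _ (quotientEquiv α β I).toEquiv
    -- The chosen exponents are forced, because the lattice determines its diagonal.
    obtain ⟨h₁, h₂, h₃⟩ := exponents_eq_of_lattice_eq hϖ ((he ⟨I, hfin⟩).symm.trans hI)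
    exact ⟨⟨⟨I, hfin⟩, Prod.ext h₁ (Prod.ext h₂ h₃)⟩, Subtype.ext hI⟩

end Coordinates

/-! ### The generating function and its evaluation. -/

section Series

open PowerSeries Finset

/-- The generating function of the number of stable lattices, by the index. -/
noncomputable def latticeSeries (q : ℤ) : ℤ⟦X⟧ :=
  PowerSeries.mk fun n => ∑ x ∈ antidiagonal n, ∑ y ∈ antidiagonal x.1,
    latticeCount q y.1 y.2 x.2

theorem latticeCount_min (q : ℤ) (a b c : ℕ) :
    latticeCount q (min a 2) (min b 2) (min c 2) = latticeCount q a b c := by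
  rcases a with _ | _ | a <;> rcases b with _ | _ | b <;> rcases c with _ | _ | c <;>
    simp [latticeCount]

/-- The indicator function of the set of all `n` with `min n 2 = i`. -/
def truncInd (i : Fin 3) (n : ℕ) : ℤ := if min n 2 = i then 1 else 0

theorem latticeCount_eq_sum (q : ℤ) (a b c : ℕ) : latticeCount q a b c =
    ∑ t : Fin 3 × Fin 3 × Fin 3, latticeCount q t.1 t.2.1 t.2.2 *
      (truncInd t.1 a * truncInd t.2.1 b * truncInd t.2.2 c) := by
  let m (n : ℕ) : Fin 3 := ⟨min n 2, by omega⟩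
  have hm (i : Fin 3) (n : ℕ) : truncInd i n = if i = m n then 1 else 0 := by
    simp only [truncInd, m, Fin.ext_iff, eq_comm]
  rw [sum_eq_single (m a, m b, m c)]
  · simp [hm, m, latticeCount_min]
  · rintro ⟨i, j, k⟩ - h
    simp only [hm, mul_eq_zero, ite_eq_right_iff, one_ne_zero, imp_false]
    contrapose! h
    simp [h.2.1.1, h.2.1.2, h.2.2]
  · simp

theorem latticeSeries_eq_sum (q : ℤ) : latticeSeries q =
    ∑ t : Fin 3 × Fin 3 × Fin 3, C (latticeCount q t.1 t.2.1 t.2.2) *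
      (PowerSeries.mk (truncInd t.1) * PowerSeries.mk (truncInd t.2.1) *
        PowerSeries.mk (truncInd t.2.2)) := by
  ext n
  simp only [latticeSeries, coeff_mk, map_sum, coeff_C_mul]
  simp only [coeff_mul, coeff_mk, sum_mul, mul_sum]
  simp only [latticeCount_eq_sum q (Prod.fst _)]
  rw [sum_comm]
  refine sum_congr rfl fun x _ => ?_
  rw [sum_comm]

/-- The three indicator series are `1`, `X` and `X ^ 2 / (1 - X)`. -/
theorem one_sub_X_mul_truncInd (i : Fin 3) : (1 - X : ℤ⟦X⟧) * PowerSeries.mk (truncInd i) =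
    ![1 - X, X * (1 - X), X ^ 2] i := by
  ext n
  rw [sub_mul, one_mul, map_sub, coeff_mk]
  fin_cases i <;> rcases n with _ | _ | _ | n <;>
    simp [truncInd, mul_sub, coeff_X, coeff_one, coeff_succ_X_mul, ← pow_two, coeff_X_pow]

/-- The numerator of the zeta function. -/
noncomputable def numerator (q : ℤ) : Polynomial ℤ :=
  .C q ^ 3 * .X ^ 6 - 2 * .C q ^ 2 * .X ^ 5 + (.C q ^ 2 + .C q) * .X ^ 4 +
    (.C q ^ 2 - 2 * .C q) * .X ^ 3 + (.C q + 1) * .X ^ 2 - 2 * .X + 1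

theorem coe_numerator (q : ℤ) : (numerator q : ℤ⟦X⟧) =
    (q : ℤ⟦X⟧) ^ 3 * X ^ 6 - 2 * (q : ℤ⟦X⟧) ^ 2 * X ^ 5 + ((q : ℤ⟦X⟧) ^ 2 + (q : ℤ⟦X⟧)) * X ^ 4 +
      ((q : ℤ⟦X⟧) ^ 2 - 2 * (q : ℤ⟦X⟧)) * X ^ 3 +
      ((q : ℤ⟦X⟧) + 1) * X ^ 2 - 2 * X + 1 := by
  have h2 : ((2 : Polynomial ℤ) : ℤ⟦X⟧) = 2 :=
    map_ofNat (Polynomial.coeToPowerSeries.ringHom (R := ℤ)) 2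
  have hq : ((q : Polynomial ℤ) : ℤ⟦X⟧) = q :=
    map_intCast (Polynomial.coeToPowerSeries.ringHom (R := ℤ)) q
  simp [numerator, h2, hq]

theorem one_sub_X_pow_mul_latticeSeries (q : ℤ) :
    (1 - X) ^ 3 * latticeSeries q = (numerator q : ℤ⟦X⟧) := by
  have key (t : Fin 3 × Fin 3 × Fin 3) : (1 - X : ℤ⟦X⟧) ^ 3 *
      (C (latticeCount q t.1 t.2.1 t.2.2) * (PowerSeries.mk (truncInd t.1) *
        PowerSeries.mk (truncInd t.2.1) * PowerSeries.mk (truncInd t.2.2))) =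
      C (latticeCount q t.1 t.2.1 t.2.2) * (![1 - X, X * (1 - X), X ^ 2] t.1 *
        ![1 - X, X * (1 - X), X ^ 2] t.2.1 * ![1 - X, X * (1 - X), X ^ 2] t.2.2) := by
    simp only [← one_sub_X_mul_truncInd]
    ring
  rw [coe_numerator, latticeSeries_eq_sum, mul_sum, sum_congr rfl fun t _ => key t]
  simp [Fintype.sum_prod_type, Fin.sum_univ_three, latticeCount]
  ring

/-- The power series `f` converges absolutely at `x`, and its value is `y`. -/
def EvalsTo (f : ℤ⟦X⟧) (x y : ℂ) : Prop :=
  Summable (fun n => ‖((coeff n f : ℤ) : ℂ) * x ^ n‖) ∧ ∑' n, ((coeff n f : ℤ) : ℂ) * x ^ n = y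

theorem EvalsTo.mul {f g : ℤ⟦X⟧} {x y z : ℂ} (hf : EvalsTo f x y) (hg : EvalsTo g x z) :
    EvalsTo (f * g) x (y * z) := by
  have h (n : ℕ) : ((coeff n (f * g) : ℤ) : ℂ) * x ^ n = ∑ k ∈ antidiagonal n,
      ((coeff k.1 f : ℤ) : ℂ) * x ^ k.1 * (((coeff k.2 g : ℤ) : ℂ) * x ^ k.2) := by
    rw [coeff_mul, Int.cast_sum, sum_mul]
    refine sum_congr rfl fun k hk => ?_
    rw [← HasAntidiagonal.mem_antidiagonal.1 hk, pow_add]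
    push_cast
    ring
  refine ⟨(summable_norm_sum_mul_antidiagonal_of_summable_norm hf.1 hg.1).congr
    fun n => congrArg _ (h n).symm, (tsum_congr h).trans ?_⟩
  refine (tsum_mul_tsum_eq_tsum_sum_antidiagonal_of_summable_norm hf.1 hg.1).symm.trans ?_
  rw [hf.2, hg.2]

theorem evalsTo_polynomial (P : Polynomial ℤ) (x : ℂ) :
    EvalsTo (P : ℤ⟦X⟧) x (P.aeval x) := by
  have h : ∀ n ∉ range (P.natDegree + 1), ((coeff n (P : ℤ⟦X⟧) : ℤ) : ℂ) * x ^ n = 0 := by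
    intro n hn
    rw [Polynomial.coeff_coe, Polynomial.coeff_eq_zero_of_natDegree_lt (by simpa using hn)]
    simp
  refine ⟨summable_of_ne_finset_zero (s := range (P.natDegree + 1)) fun n hn => by
    rw [h n hn, norm_zero], ?_⟩
  rw [tsum_eq_sum h, Polynomial.aeval_eq_sum_range]
  simp

theorem evalsTo_mk_one {x : ℂ} (hx : ‖x‖ < 1) : EvalsTo (PowerSeries.mk 1) x (1 - x)⁻¹ := by
  constructor
  · simpa using summable_geometric_of_lt_one (norm_nonneg x) hx
  · simpa using tsum_geometric_of_norm_lt_one hx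

theorem evalsTo_latticeSeries (q : ℤ) {x : ℂ} (hx : ‖x‖ < 1) :
    EvalsTo (latticeSeries q) x ((numerator q).aeval x * ((1 - x)⁻¹ * (1 - x)⁻¹ * (1 - x)⁻¹)) := by
  have h1 : PowerSeries.mk 1 * (1 - X) = (1 : ℤ⟦X⟧) := mk_one_mul_one_sub_eq_one ℤ
  have : latticeSeries q = (numerator q : ℤ⟦X⟧) *
      (PowerSeries.mk 1 * PowerSeries.mk 1 * PowerSeries.mk 1) := by
    rw [← one_sub_X_pow_mul_latticeSeries]
    calc latticeSeries q = (PowerSeries.mk 1 * (1 - X)) ^ 3 * latticeSeries q := by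
          rw [h1, one_pow, one_mul]
      _ = _ := by ring
  rw [this]
  have h := evalsTo_mk_one hx
  exact (evalsTo_polynomial _ x).mul ((h.mul h).mul h)

theorem natCard_eq_sum_antidiagonal {ι : Type*} (e : ι → ℕ × ℕ × ℕ)
    (he : ∀ a b c, Finite {i // e i = (a, b, c)}) (n : ℕ) :
    Finite {i // (e i).1 + (e i).2.1 + (e i).2.2 = n} ∧
      Nat.card {i // (e i).1 + (e i).2.1 + (e i).2.2 = n} = ∑ x ∈ antidiagonal n,
        ∑ y ∈ antidiagonal x.1, Nat.card {i // e i = (y.1, y.2, x.2)} := by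
  let T := (antidiagonal n).sigma fun x => antidiagonal x.1
  let f (z : Σ t : T, {i // e i = (t.1.2.1, t.1.2.2, t.1.1.2)}) :
      {i // (e i).1 + (e i).2.1 + (e i).2.2 = n} := ⟨z.2.1, by
    have := z.1.2
    simp only [T, mem_sigma, HasAntidiagonal.mem_antidiagonal] at this
    rw [z.2.2]
    dsimp only
    omega⟩
  have hf : Function.Bijective f := by
    constructor
    · rintro ⟨⟨⟨⟨m, c⟩, a, b⟩, ht⟩, i, hi⟩ ⟨⟨⟨⟨m', c'⟩, a', b'⟩, ht'⟩, i', hi'⟩ h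
      obtain rfl : i = i' := congrArg Subtype.val h
      simp only [hi, Prod.mk.injEq] at hi'
      simp only [T, mem_sigma, HasAntidiagonal.mem_antidiagonal] at ht ht'
      obtain ⟨rfl, rfl, rfl⟩ := hi'
      obtain rfl : m = m' := by omega
      rfl
    · rintro ⟨i, hi⟩
      exact ⟨⟨⟨⟨((e i).1 + (e i).2.1, (e i).2.2), ((e i).1, (e i).2.1)⟩, by simp [T, hi]⟩,
        i, rfl⟩, rfl⟩
  refine ⟨Finite.of_surjective f hf.2, ?_⟩
  rw [← Nat.card_eq_of_bijective f hf, Nat.card_sigma, sum_coe_sort T fun t =>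
    Nat.card {i // e i = (t.2.1, t.2.2, t.1.2)}, sum_sigma]

/-- The terms are constant on the finite fibres of `w`, so summing norms fibrewise gives the
absolutely convergent power series. -/
theorem tsum_pow_eq_of_evalsTo {ι : Type*} (w : ι → ℕ) (hw : ∀ n, Finite {i // w i = n})
    {f : ℤ⟦X⟧} (hf : ∀ n, (Nat.card {i // w i = n} : ℤ) = coeff n f) {x y : ℂ}
    (h : EvalsTo f x y) : Summable (fun i => x ^ w i) ∧ ∑' i, x ^ w i = y := by
  have hc (n : ℕ) : ((coeff n f : ℤ) : ℂ) = Nat.card {i // w i = n} := by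
    rw [← hf]
    simp
  have hval (n : ℕ) (i : {i // w i = n}) : w i = n := i.2
  have hs : Summable fun z : Σ n, {i // w i = n} => x ^ w z.2 := by
    apply Summable.of_norm
    refine (summable_sigma_of_nonneg fun _ => norm_nonneg _).2
      ⟨fun n => Summable.of_finite, h.1.congr fun n => ?_⟩
    simp [hval, hc, tsum_const]
  refine ⟨(Equiv.sigmaFiberEquiv w).summable_iff.1 hs, ?_⟩
  rw [← (Equiv.sigmaFiberEquiv w).tsum_eq, ← h.2]
  refine (hs.tsum_sigma' fun n => Summable.of_finite).trans (tsum_congr fun n => ?_)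
  simp [hval, hc, tsum_const]

end Series

/-! ### The localization at `p` as a discrete valuation ring with residue field of order `p`. -/

section Localization

open IsLocalRing

variable (p : ℕ) [hp : Fact p.Prime]

theorem span_natCast_ne_bot : Ideal.span {(p : ℤ)} ≠ ⊥ := by
  simpa using hp.out.ne_zero

instance span_natCast_isMaximal : (Ideal.span {(p : ℤ)}).IsMaximal :=
  (cubicOrder_span_isPrime p).isMaximal (span_natCast_ne_bot p)

instance zloc_isDiscreteValuationRing : IsDiscreteValuationRing (Zloc p) :=
  IsLocalization.AtPrime.isDiscreteValuationRing_of_dedekind_domain ℤ (span_natCast_ne_bot p) _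

theorem maximalIdeal_zloc : maximalIdeal (Zloc p) = Ideal.span {(p : Zloc p)} := by
  rw [← IsLocalization.AtPrime.map_eq_maximalIdeal (Ideal.span {(p : ℤ)}) (Zloc p),
    Ideal.map_span, Set.image_singleton, map_natCast]

theorem irreducible_natCast_zloc : Irreducible (p : Zloc p) :=
  (IsDiscreteValuationRing.irreducible_iff_uniformizer _).2 (maximalIdeal_zloc p)

/-- The residue field of the localization at `p` is `ℤ / p`. -/
noncomputable def zmodEquivResidueField : ZMod p ≃+* ResidueField (Zloc p) :=
  (Int.quotientSpanEquivZMod p).symm.trans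
    (IsLocalization.AtPrime.equivQuotMaximalIdeal (Ideal.span {(p : ℤ)}) (Zloc p))

instance finite_residueField_zloc : Finite (ResidueField (Zloc p)) :=
  Finite.of_equiv _ (zmodEquivResidueField p).toEquiv

theorem natCard_residueField_zloc : Nat.card (ResidueField (Zloc p)) = p := by
  rw [← Nat.card_congr (zmodEquivResidueField p).toEquiv, Nat.card_zmod]

theorem exists_unit_of_val_eq_one {x : Zloc p} (h : val p x = 1) : ∃ u : (Zloc p)ˣ, x = p * u := by
  obtain ⟨⟨u, hu'⟩, h₂⟩ := (emultiplicity_eq_coe (n := 1)).1 h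
  have hu : IsUnit u := by
    by_contra hu
    rw [← mem_nonunits_iff, ← mem_maximalIdeal, maximalIdeal_zloc,
      Ideal.mem_span_singleton] at hu
    obtain ⟨w, rfl⟩ := hu
    exact h₂ ⟨w, by rw [hu']; ring⟩
  exact ⟨hu.unit, by rw [hu', pow_one, hu.unit_spec]⟩

end Localization

/-! ### Passage from lattice counts to the formal Dirichlet series. -/

section Zeta

variable (p : ℕ) [hp : Fact p.Prime] {α β : ℤ}

theorem exists_exponent (hα : val p (α : Zloc p) = 1) (hβ : val p (β : Zloc p) = 1)
    (hβα : val p ((β - α : ℤ) : Zloc p) = 1) : ∃ w : FullIdeal p α β → ℕ,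
      (∀ I, index p α β I = p ^ w I) ∧ (∀ n, Finite {I // w I = n}) ∧
      ∀ n, (Nat.card {I // w I = n} : ℤ) = PowerSeries.coeff n (latticeSeries p) := by
  have hϖ := irreducible_natCast_zloc p
  obtain ⟨A, hA⟩ := exists_unit_of_val_eq_one p hα
  obtain ⟨B, hB⟩ := exists_unit_of_val_eq_one p hβ
  obtain ⟨D, hD⟩ := exists_unit_of_val_eq_one p hβα
  have hD' : (D : Zloc p) = B - A := by
    apply mul_left_cancel₀ hϖ.ne_zero
    rw [mul_sub, ← hA, ← hB, ← hD, Int.cast_sub]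
  obtain ⟨e, he, hcard⟩ := exists_exponents hϖ (α : Zloc p) (β : Zloc p)
  simp only [natCard_residueField_zloc] at he
  have hfin (a b c : ℕ) : Finite {I // e I = (a, b, c)} :=
    have := (finite_stableLattices hϖ (α : Zloc p) (β : Zloc p) a b c).to_subtype
    Finite.of_equiv _ (hcard a b c).some.symm
  refine ⟨fun I => (e I).1 + (e I).2.1 + (e I).2.2, he,
    fun n => (natCard_eq_sum_antidiagonal e hfin n).1, fun n => ?_⟩
  refine (congrArg _ (natCard_eq_sum_antidiagonal e hfin n).2).trans ?_
  rw [latticeSeries, PowerSeries.coeff_mk]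
  push_cast
  refine Finset.sum_congr rfl fun x _ => Finset.sum_congr rfl fun y _ => ?_
  rw [Nat.card_congr (hcard _ _ _).some, hA, hB, natCard_stableLattices hϖ A B D hD',
    natCard_residueField_zloc]

open ArithmeticFunction in
theorem formalX_eq_ofPowerSeries :
    formalX p = ofPowerSeries p (PowerSeries.X : PowerSeries ℤ) := by
  ext n
  rw [ofPowerSeries_apply hp.out.one_lt]
  by_cases h : ∃ k, p ^ k = n
  · obtain ⟨k, rfl⟩ := h
    have : p ^ k = p ↔ k = 1 := by
      simpa using Nat.pow_right_inj hp.out.one_lt (m := k) (n := 1)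
    rw [(Nat.pow_right_injective hp.out.one_lt).extend_apply, PowerSeries.coeff_X]
    simp [formalX, this]
  · rw [Function.extend_apply' _ _ _ h]
    have : n ≠ p := fun hn => h ⟨1, by simp [hn]⟩
    simp [formalX, this]

open ArithmeticFunction in
theorem formalZeta_eq_ofPowerSeries {w : FullIdeal p α β → ℕ}
    (hw : ∀ I, index p α β I = p ^ w I) {f : PowerSeries ℤ}
    (hf : ∀ n, (Nat.card {I // w I = n} : ℤ) = PowerSeries.coeff n f) :
    formalZeta p α β = ofPowerSeries p f := by
  ext n
  rw [ofPowerSeries_apply hp.out.one_lt]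
  by_cases h : ∃ k, p ^ k = n
  · obtain ⟨k, rfl⟩ := h
    rw [(Nat.pow_right_injective hp.out.one_lt).extend_apply, ← hf]
    simp [formalZeta, hw, hp.out.ne_zero, Nat.pow_right_inj hp.out.one_lt]
  · rw [Function.extend_apply' _ _ _ h]
    have : IsEmpty {I : FullIdeal p α β // index p α β I = n} :=
      ⟨fun I => h ⟨w I.1, (hw I.1).symm.trans I.2⟩⟩
    simp [formalZeta]

end Zeta

end CubicOrder

theorem proposition4p2 (p : ℕ) [Fact p.Prime] (α β : ℤ)
    (hα : CubicOrder.val p (α : CubicOrder.Zloc p) = 1)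
    (hβ : CubicOrder.val p (β : CubicOrder.Zloc p) = 1)
    (hβα : CubicOrder.val p ((β - α : ℤ) : CubicOrder.Zloc p) = 1) :
    -- there are only finitely many ideals of each index, and the identity of
    -- formal Dirichlet series holds
    ((∀ n : ℕ, {I : CubicOrder.FullIdeal p α β | CubicOrder.index p α β I = n}.Finite) ∧
      ∀ x : ArithmeticFunction ℤ, x = CubicOrder.formalX p →
        (1 - x) ^ 3 * CubicOrder.formalZeta p α β =
          (p : ArithmeticFunction ℤ) ^ 3 * x ^ 6 - 2 * (p : ArithmeticFunction ℤ) ^ 2 * x ^ 5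
            + ((p : ArithmeticFunction ℤ) ^ 2 + (p : ArithmeticFunction ℤ)) * x ^ 4
            + ((p : ArithmeticFunction ℤ) ^ 2 - 2 * (p : ArithmeticFunction ℤ)) * x ^ 3
            + ((p : ArithmeticFunction ℤ) + 1) * x ^ 2 - 2 * x + 1) ∧
    -- for `Re s > 0` the series converges absolutely and the identity of functions holds
    (∀ s : ℂ, 0 < s.re →
      Summable (fun I : CubicOrder.FullIdeal p α β => (CubicOrder.index p α β I : ℂ) ^ (-s)) ∧
      ∀ x : ℂ, x = (p : ℂ) ^ (-s) →
        (1 - x) ^ 3 * CubicOrder.zeta p α β s =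
          (p : ℂ) ^ 3 * x ^ 6 - 2 * (p : ℂ) ^ 2 * x ^ 5 + ((p : ℂ) ^ 2 + (p : ℂ)) * x ^ 4
            + ((p : ℂ) ^ 2 - 2 * (p : ℂ)) * x ^ 3 + ((p : ℂ) + 1) * x ^ 2 - 2 * x + 1) := by
  have hp : p.Prime := Fact.out
  obtain ⟨w, hw, hfin, hcard⟩ := CubicOrder.exists_exponent p hα hβ hβα
  refine ⟨⟨fun n => ?_, ?_⟩, fun s hs => ?_⟩
  · by_cases h : ∃ k, p ^ k = n
    · obtain ⟨k, rfl⟩ := h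
      have : Finite {I | w I = k} := hfin k
      simpa [hw, Nat.pow_right_inj hp.one_lt] using Set.toFinite {I | w I = k}
    · convert Set.finite_empty
      exact Set.eq_empty_of_forall_notMem fun I hI => h ⟨w I, (hw I).symm.trans hI⟩
  · rintro x rfl
    have h (φ : PowerSeries ℤ →+* ArithmeticFunction ℤ) :=
      congrArg φ (CubicOrder.one_sub_X_pow_mul_latticeSeries p)
    simp only [CubicOrder.coe_numerator, Int.cast_natCast, map_add, map_sub, map_mul, map_pow,
      map_one, map_ofNat, map_natCast] at h
    rw [CubicOrder.formalX_eq_ofPowerSeries, CubicOrder.formalZeta_eq_ofPowerSeries p hw hcard]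
    exact h (ArithmeticFunction.ofPowerSeries p : PowerSeries ℤ →ₐ[ℤ] ArithmeticFunction ℤ)
  · have hx : ‖(p : ℂ) ^ (-s)‖ < 1 := by
      rw [Complex.norm_natCast_cpow_of_pos hp.pos]
      exact Real.rpow_lt_one_of_one_lt_of_neg (by exact_mod_cast hp.one_lt) (by simpa using hs)
    have hterm (I : CubicOrder.FullIdeal p α β) :
        (CubicOrder.index p α β I : ℂ) ^ (-s) = ((p : ℂ) ^ (-s)) ^ w I := by
      rw [hw, Nat.cast_pow, ← Complex.natCast_cpow_natCast_mul, Complex.cpow_nat_mul]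
    obtain ⟨hsum, htsum⟩ := CubicOrder.tsum_pow_eq_of_evalsTo w hfin hcard
      (CubicOrder.evalsTo_latticeSeries p hx)
    simp only [CubicOrder.zeta, hterm]
    refine ⟨hsum, ?_⟩
    rintro x rfl
    have hne : 1 - (p : ℂ) ^ (-s) ≠ 0 := by
      intro h
      rw [← sub_eq_zero.1 h, norm_one] at hx
      exact lt_irrefl _ hx
    have h2 : (2 : Polynomial ℤ).aeval ((p : ℂ) ^ (-s)) = 2 := map_ofNat _ 2
    calc _ = (CubicOrder.numerator p).aeval ((p : ℂ) ^ (-s)) := by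
          rw [htsum]
          field_simp
      _ = _ := by simp [CubicOrder.numerator, h2]
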